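/- Let $F$ be a $p$-adic field with ring of integers $\mathcal O_F$, uniformizer $\pi_F$ and residue field with $q$ elements, and normalize the absolute value of $F$ by $|\pi_F| = q^{-1}$. For a standard (block upper triangular) parabolic subgroup $P = MN$ of $GL_n$, with block diagonal Levi subgroup $M$ and unipotent radical $N$ with Lie algebra $\mathfrak n$, and for a locally constant compactly supported $f : GL_n(F) \to \mathbb C$, the constant term of $f$ is the function on $M(F)$ $$f^{(P)}(m) = |\det(m, \mathfrak n)|^{1/2} \int_{N(F)} f(m u)\, du ,$$ where $m$ acts on $\mathfrak n$ by conjugation and the Haar measure on $N(F)$ gives $N(F) \cap GL_n(\mathcal O_F)$ measure $1$. Let $T$ be the diagonal torus and $P_0$ the upper triangular Borel subgroup. Identify $\mathbb C[X_1^{\pm 1}, \dots, X_n^{\pm 1}]$ with the algebra of compactly supported $T(\mathcal O_F)$-invariant functions on $T(F)$, so that $X_k$ is the characteristic function of $a_k T(\mathcal O_F)$, where $a_k$ is diagonal with entry $\pi_F$ at $k$ and $1$ elsewhere. For $s \le n$ and $\alpha \ge 1$, let $f_{n\alpha s}$ be the locally constant, compactly supported, $GL_n(\mathcal O_F)$-bi-invariant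 function on $GL_n(F)$ whose Satake transform $f_{n\alpha s}^{(P_0)}$ is $$q^{\alpha s(n-s)/2} \sum_{I \subseteq \{1,\dots,n\},\ |I| = s} \Big(\prod_{i \in I} X_i\Big)^{\alpha} .$$ Let $C_c^{GL_n(F)}$ be the characteristic function of the set of those $g \in GL_n(F)$ all of whose eigenvalues in an algebraic closure of $F$ have the same absolute value. **Proposition 5.1.** Let $n, s, \alpha$ be positive integers with $s \le n$ and $\gcd(s, n) = 1$. Then for every proper standard parabolic subgroup $P = MN$ of $GL_n$, $$C_c^{GL_n(F)}(m)\, f_{n\alpha s}^{(P)}(m) = 0 \qquad \text{for all } m \in M(F) .$$ -/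

import Mathlib

open scoped Matrix

noncomputable section

namespace KottwitzFunction

/-! ### The field

`F` is a locally compact nonarchimedean nontrivially normed field; in the theorem it has
characteristic zero, so it is a `p`-adic field. -/

section Field

variable (F : Type*) [NontriviallyNormedField F] [IsUltrametricDist F]

/-- The ring of integers `𝒪_F = {x | ‖x‖ ≤ 1}`. -/
abbrev integers : ValuationSubring F := (NormedField.valuation (K := F)).valuationSubring

/-- `q`, the number of elements of the residue field of `F`. -/
def residueCard : ℕ := Nat.card (IsLocalRing.ResidueField (integers F))

end Field

section Haar

variable (F : Type*) [NontriviallyNormedField F] [ProperSpace F]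

/-- The closed unit ball, as a compact set with non-empty interior. -/
def unitBall : TopologicalSpace.PositiveCompacts F where
  carrier := Metric.closedBall 0 1
  isCompact' := isCompact_closedBall 0 1
  interior_nonempty' :=
    ⟨0, Metric.ball_subset_interior_closedBall (Metric.mem_ball_self one_pos)⟩

/-- The additive Haar measure on `F` for which `𝒪_F` has measure one. -/
def haarF [MeasurableSpace F] [BorelSpace F] : MeasureTheory.Measure F :=
  MeasureTheory.Measure.addHaarMeasure (unitBall F)

end Haar

/-! ### Standard parabolic subgroups of `GL_n`

A partition `(n_1, …, n_k)` of `n` in the sense of an ordered tuple of positive integers is a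
`Composition n`, and `c.index i` is the block that contains the index `i`. -/

section Parabolic

variable {n : ℕ} (c : Composition n) (F : Type*) [Field F]

/-- The standard parabolic subgroup `P(F)` of `GL_n(F)`: block upper triangular matrices. -/
def parabolic : Subgroup (GL (Fin n) F) where
  carrier := {g | Matrix.BlockTriangular (g : Matrix (Fin n) (Fin n) F) c.index}
  mul_mem' ha hb := by
    simpa using Matrix.BlockTriangular.mul ha hb
  one_mem' := by
    simpa using Matrix.blockTriangular_one
  inv_mem' {g} hg := by
    have := g.invertible
    simpa using Matrix.blockTriangular_inv_of_blockTriangular hg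

/-- The standard Levi subgroup `M(F) = GL_{n_1}(F) × ⋯ × GL_{n_k}(F)` of `P(F)`: block diagonal
matrices. -/
def levi : Subgroup (GL (Fin n) F) where
  carrier := {g | Matrix.BlockTriangular (g : Matrix (Fin n) (Fin n) F) c.index ∧
    Matrix.BlockTriangular (g : Matrix (Fin n) (Fin n) F) (OrderDual.toDual ∘ c.index)}
  mul_mem' ha hb := by
    simpa using And.intro (Matrix.BlockTriangular.mul ha.1 hb.1)
      (Matrix.BlockTriangular.mul ha.2 hb.2)
  one_mem' := by
    simpa using And.intro Matrix.blockTriangular_one Matrix.blockTriangular_one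
  inv_mem' {g} hg := by
    have := g.invertible
    simpa using And.intro (Matrix.blockTriangular_inv_of_blockTriangular hg.1)
      (Matrix.blockTriangular_inv_of_blockTriangular hg.2)

theorem mem_levi_iff {g : GL (Fin n) F} :
    g ∈ levi c F ↔ ∀ i j, c.index i ≠ c.index j → g i j = 0 := by
  constructor
  · rintro ⟨h1, h2⟩ i j hij
    rcases lt_or_gt_of_ne hij with h | h
    · exact h2 (OrderDual.toDual_lt_toDual.2 h)
    · exact h1 h
  · intro h
    exact ⟨fun i j hij => h i j (ne_of_gt hij),
      fun i j hij => h i j (ne_of_lt (OrderDual.toDual_lt_toDual.1 hij))⟩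

/-- The positions `(i, j)` strictly above the diagonal blocks. -/
abbrev NilIndex : Type := {ij : Fin n × Fin n // c.index ij.1 < c.index ij.2}

/-- The Lie algebra `𝔫` of the unipotent radical `N` of `P`: a family of entries at the positions
strictly above the diagonal blocks, viewed as a matrix. -/
def nilMatrix : (NilIndex c → F) →ₗ[F] Matrix (Fin n) (Fin n) F where
  toFun x := Matrix.of fun i j => if h : c.index i < c.index j then x ⟨(i, j), h⟩ else 0
  map_add' x y := by
    ext i j
    by_cases h : c.index i < c.index j <;> simp [h]
  map_smul' a x := by
    ext i j
    by_cases h : c.index i < c.index j <;> simp [h]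

variable {F} in
/-- The adjoint action `X ↦ m X m⁻¹` of `m` on `𝔫`, in the coordinates of `𝔫`. (If `m ∈ P(F)`
then `m X m⁻¹` lies in `𝔫` for every `X ∈ 𝔫`.) -/
def adjointAction (m : GL (Fin n) F) : (NilIndex c → F) →ₗ[F] (NilIndex c → F) where
  toFun x ij :=
    ((m : Matrix (Fin n) (Fin n) F) * nilMatrix c F x *
      ((m⁻¹ : GL (Fin n) F) : Matrix (Fin n) (Fin n) F)) ij.1.1 ij.1.2
  map_add' x y := by
    ext ij
    simp [mul_add, add_mul]
  map_smul' a x := by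
    ext ij
    simp

variable {c} in
theorem index_mono {i j : Fin n} (hij : i ≤ j) : c.index i ≤ c.index j := by
  by_contra h
  rw [not_le] at h
  have h1 := c.sizeUpTo_index_le i
  have h2 := c.lt_sizeUpTo_index_succ j
  have h3 : c.sizeUpTo (c.index j).succ ≤ c.sizeUpTo (c.index i) :=
    c.monotone_sizeUpTo (by rw [Fin.val_succ]; exact h)
  have h4 : (i : ℕ) ≤ j := hij
  omega

theorem det_one_add_nilMatrix (x : NilIndex c → F) :
    (1 + nilMatrix c F x).det = 1 := by
  have hle : ∀ i j : Fin n, j ≤ i → nilMatrix c F x i j = 0 := fun i j hij => by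
    have h := not_lt.2 (index_mono (c := c) hij)
    exact dif_neg h
  rw [Matrix.det_of_isUpperTriangular]
  · exact Finset.prod_eq_one fun i _ => by simp [hle i i le_rfl]
  · intro i j hij
    have hij' : j < i := hij
    simp [hle i j hij'.le, Matrix.one_apply_ne hij'.ne']

variable {F} in
/-- The element `1 + X` of the unipotent radical `N(F)` attached to `X ∈ 𝔫`. The map
`X ↦ 1 + X` is a bijection from `𝔫` onto `N(F)`. -/
def unipotent (x : NilIndex c → F) : GL (Fin n) F :=
  Matrix.GeneralLinearGroup.mkOfDetNeZero (1 + nilMatrix c F x)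
    (by rw [det_one_add_nilMatrix]; exact one_ne_zero)

end Parabolic

/-! ### The unramified Hecke algebra, constant terms, the Satake transform -/

section Hecke

variable {n : ℕ} {F : Type*} [NontriviallyNormedField F] [IsUltrametricDist F]

variable (n F) in
/-- The hyperspecial maximal compact subgroup `GL_n(𝒪_F)` of `GL_n(F)`. -/
def maximalCompact : Subgroup (GL (Fin n) F) :=
  (Matrix.GeneralLinearGroup.map (n := Fin n) (integers F).subtype).range

/-- `f` belongs to the unramified Hecke algebra of `GL_n(F)`: it is locally constant, compactly
supported and bi-invariant under `GL_n(𝒪_F)`. -/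
structure IsUnramified (f : GL (Fin n) F → ℂ) : Prop where
  isLocallyConstant : IsLocallyConstant f
  hasCompactSupport : HasCompactSupport f
  biinvariant : ∀ k₁ ∈ maximalCompact n F, ∀ k₂ ∈ maximalCompact n F, ∀ g,
    f (k₁ * g * k₂) = f g

/-- The modular character `δ_P(m) = |det(m, 𝔫)|`. -/
def modularCharacter (c : Composition n) (m : GL (Fin n) F) : ℝ :=
  ‖LinearMap.det (adjointAction c m)‖

/-- The constant term `f^{(P)}(m) = δ_P(m)^{1/2} ∫_{N(F)} f(m n) dn` for `m ∈ M(F)`. The Haar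
measure on `N(F)` is the product of the measures `haarF F` in the matrix coordinates of `N`, so
that `N(F) ∩ GL_n(𝒪_F)` has measure one. -/
def constantTerm [ProperSpace F] [MeasurableSpace F] [BorelSpace F] (c : Composition n)
    (f : GL (Fin n) F → ℂ) (m : levi c F) : ℂ :=
  ((modularCharacter c (m : GL (Fin n) F) ^ (1 / 2 : ℝ) : ℝ) : ℂ) *
    ∫ x : NilIndex c → F, f ((m : GL (Fin n) F) * unipotent c x)
      ∂(MeasureTheory.Measure.pi fun _ => haarF F)

variable (n F) in
/-- The diagonal torus `T(F)`: the standard Levi subgroup of the Borel subgroup of upper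
triangular matrices, which belongs to the partition `(1, …, 1)`. -/
abbrev torus : Subgroup (GL (Fin n) F) := levi (Composition.ones n) F

/-- The Satake transform `f ↦ f^{(P_0)}`, with `P_0` the Borel subgroup of upper triangular
matrices. -/
def satake [ProperSpace F] [MeasurableSpace F] [BorelSpace F] (f : GL (Fin n) F → ℂ) :
    torus n F → ℂ :=
  constantTerm (Composition.ones n) f

/-- The ring `ℂ[X_1^{±1}, …, X_n^{±1}]` of Laurent polynomials. -/
abbrev LaurentRing (n : ℕ) : Type := AddMonoidAlgebra ℂ (Fin n → ℤ)

/-- The variable `X_i`. -/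
def X (i : Fin n) : LaurentRing n := AddMonoidAlgebra.single (Pi.single i 1) 1

open Classical in
/-- The identification of `ℂ[X_1^{±1}, …, X_n^{±1}]` with the unramified Hecke algebra of `T(F)`
for which `X_k` is the characteristic function of `T(𝒪_F) a_k T(𝒪_F)`, where `a_k` is diagonal
with entry `ϖ` at `k` and `1` elsewhere. The monomial `X^l` goes to the characteristic function
of the coset of `T(𝒪_F)` that consists of the `t` with `‖t_i‖ = ‖ϖ‖ ^ l_i` for all `i`. -/
def toTorusFunction (ϖ : integers F) (Q : LaurentRing n) (t : torus n F) : ℂ :=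
  Q.coeff.sum fun l a =>
    if ∀ i, ‖(t : GL (Fin n) F) i i‖ = ‖(ϖ : F)‖ ^ (l i) then a else 0

/-- The polynomial `q^{α s (n - s) / 2} ∑_{I ⊆ {1, …, n}, |I| = s} (X^I)^α`, with
`X^I = ∏_{i ∈ I} X_i`. -/
def kottwitzPolynomial (q n α s : ℕ) : LaurentRing n :=
  (((q : ℝ) ^ ((α : ℝ) * s * ((n : ℝ) - s) / 2) : ℝ) : ℂ) •
    ∑ I ∈ Finset.powersetCard s (Finset.univ : Finset (Fin n)), (∏ i ∈ I, X i) ^ α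

/-- `f` is the function `f_{n α s}`: the element of the unramified Hecke algebra of `GL_n(F)`
whose Satake transform is `q^{α s (n - s) / 2} ∑_{|I| = s} (X^I)^α`. -/
structure IsKottwitzFunction [ProperSpace F] [MeasurableSpace F] [BorelSpace F]
    (ϖ : integers F) (α s : ℕ) (f : GL (Fin n) F → ℂ) : Prop where
  isUnramified : IsUnramified f
  satake_eq : satake f = toTorusFunction ϖ (kottwitzPolynomial (residueCard F) n α s)

end Hecke

/-! ### Compact elements -/

section Compact

variable {n : ℕ} {F : Type*} [NontriviallyNormedField F]

variable (n F) in
/-- The set of compact elements of `GL_n(F)`: all eigenvalues in an algebraic closure of `F` have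
the same norm, for the unique extension of the norm of `F`. -/
def compactElements : Set (GL (Fin n) F) :=
  {g | ∀ x ∈ (g : Matrix (Fin n) (Fin n) F).charpoly.aroots (AlgebraicClosure F),
    ∀ y ∈ (g : Matrix (Fin n) (Fin n) F).charpoly.aroots (AlgebraicClosure F),
      spectralNorm F (AlgebraicClosure F) x = spectralNorm F (AlgebraicClosure F) y}

variable (n F) in
/-- `C_c^{GL_n(F)}`, the characteristic function of the set of compact elements of `GL_n(F)`. -/
def compactIndicator : GL (Fin n) F → ℂ := (compactElements n F).indicator 1

end Compact

end KottwitzFunction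

end

/-!
Up to the nonzero factor `δ_P^{1/2}` the constant term at `m` is `I_P(m) = ∫_N f(mu) du`. If
`I_P(m) ≠ 0`, choose a row `J` and, among all `g ∈ M` with `I_P(g) ≠ 0` and the same norms of block
determinants as `m`, one for which `‖g J J‖` is maximal; the maximum exists because `f` has compact
support. Row and column operations from `M(𝒪_F)`, under which `I_P` is invariant, clear the rest of
row and column `J`. The integral over `N` and the unipotents of row `J` is the integral of
`v ↦ I_P(g (1 + e_J vᵀ))`, and maximality forces this function to vanish for `‖v‖ > 1`, while it
equals `I_P(g)` for `‖v‖ ≤ 1`: no cancellation occurs. Peeling off all rows produces a diagonal `t`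
with nonzero Satake transform whose block determinants have the same norms as those of `m`.

If `m` is compact, these norms are `x ^ n_d` with `n_d` the size of the block `d`. A monomial
`(∏_{i ∈ I} X_i)^α` in the support at `t` therefore satisfies `n * #(I ∩ d) = n_d * s`, so
`n ∣ n_d`, which is impossible when `0 < n_d < n`.
-/

noncomputable section

namespace KottwitzFunction

section Field

variable {F : Type*} [NontriviallyNormedField F] [IsUltrametricDist F]

theorem mem_integers_iff {x : F} : x ∈ integers F ↔ ‖x‖ ≤ 1 :=
  Iff.rfl

theorem norm_pos_of_irreducible {ϖ : integers F} (hϖ : Irreducible ϖ) : 0 < ‖(ϖ : F)‖ :=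
  norm_pos_iff.2 fun h => hϖ.ne_zero (Subtype.ext h)

theorem norm_lt_one_of_irreducible {ϖ : integers F} (hϖ : Irreducible ϖ) : ‖(ϖ : F)‖ < 1 :=
  (Valuation.valuationSubring.integers _).valuation_irreducible_lt_one hϖ

-- The norm is locally constant away from `0`, so a maximum over the compact closure of `S` is
-- attained on `S` itself.
theorem exists_isMaxOn_norm_of_isBounded [ProperSpace F] {S : Set F} (hne : S.Nonempty)
    (hS : Bornology.IsBounded S) : ∃ x ∈ S, IsMaxOn (‖·‖) S x := by
  obtain ⟨x, hx, hmax⟩ :=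
    hS.isCompact_closure.exists_isMaxOn hne.closure continuous_norm.continuousOn
  have hmax' : ∀ y ∈ S, ‖y‖ ≤ ‖x‖ := fun y hy => hmax (subset_closure hy)
  rcases eq_or_ne x 0 with rfl | hx0
  · obtain ⟨y, hy⟩ := hne
    exact ⟨y, hy, fun z hz => ((hmax' z hz).trans_eq norm_zero).trans (norm_nonneg y)⟩
  · obtain ⟨y, hy, hxy⟩ := Metric.mem_closure_iff.1 hx ‖x‖ (norm_pos_iff.2 hx0)
    have hnorm : ‖x‖ = ‖y‖ := by
      rw [dist_eq_norm, sub_eq_add_neg] at hxy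
      simpa using IsUltrametricDist.norm_eq_of_add_norm_lt_max (lt_max_of_lt_left hxy)
    exact ⟨y, hy, fun z hz => (hmax' z hz).trans_eq hnorm⟩

theorem norm_det_le_one {ι : Type*} [Fintype ι] [DecidableEq ι] {A : Matrix ι ι F}
    (hA : ∀ i j, ‖A i j‖ ≤ 1) : ‖A.det‖ ≤ 1 := by
  rw [Matrix.det_apply]
  refine IsUltrametricDist.norm_sum_le_of_forall_le_of_nonneg zero_le_one fun σ _ => ?_
  have hsign : ‖((Equiv.Perm.sign σ : ℤ) : F)‖ = 1 := by
    rcases Int.units_eq_one_or (Equiv.Perm.sign σ) with h | h <;> simp [h]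
  rw [Units.smul_def, ← Int.cast_smul_eq_zsmul F, smul_eq_mul, norm_mul, norm_prod, hsign, one_mul]
  exact Finset.prod_le_one (fun _ _ => norm_nonneg _) fun _ _ => hA _ _

theorem norm_matrix_mul_apply_le {l m n : Type*} [Fintype m] {A : Matrix l m F}
    {B : Matrix m n F} {i : l} {j : n} {C : ℝ} (hC : 0 ≤ C)
    (h : ∀ k, ‖A i k‖ * ‖B k j‖ ≤ C) : ‖(A * B) i j‖ ≤ C := by
  rw [Matrix.mul_apply]
  exact IsUltrametricDist.norm_sum_le_of_forall_le_of_nonneg hC fun k _ =>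
    (norm_mul _ _).trans_le (h k)

end Field

section Levi

variable {n : ℕ} {β : Type*} [LinearOrder β]

/-- The group of invertible matrices that are block diagonal for the partition of the indices into
the fibres of `b`. For `b = c.index` it is the Levi subgroup `levi c F`; the proof refines `b` step
by step until the group becomes the diagonal torus. -/
def blockLevi (b : Fin n → β) (F : Type*) [Field F] : Subgroup (GL (Fin n) F) where
  carrier := {g | ∀ i j, b i ≠ b j → g i j = 0}
  mul_mem' {g h} hg hh i j hij := by
    rw [Units.val_mul, Matrix.mul_apply]
    refine Finset.sum_eq_zero fun k _ => ?_
    by_cases hik : b i = b k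
    · rw [hh k j (hik ▸ hij), mul_zero]
    · rw [hg i k hik, zero_mul]
  one_mem' i j hij := Matrix.one_apply_ne fun h => hij (congrArg b h)
  inv_mem' {g} hg i j hij := by
    have := g.invertible
    rw [Matrix.coe_units_inv]
    rcases hij.lt_or_gt with h | h
    · have hblock : Matrix.BlockTriangular g.val (OrderDual.toDual ∘ b) :=
        fun i j hij => hg i j (OrderDual.toDual_lt_toDual.1 hij).ne
      exact Matrix.blockTriangular_inv_of_blockTriangular hblock (OrderDual.toDual_lt_toDual.2 h)
    · have hblock : Matrix.BlockTriangular g.val b := fun i j hij => hg i j hij.ne'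
      exact Matrix.blockTriangular_inv_of_blockTriangular hblock h

theorem mem_blockLevi_iff {F : Type*} [Field F] {b : Fin n → β} {g : GL (Fin n) F} :
    g ∈ blockLevi b F ↔ ∀ i j, b i ≠ b j → g i j = 0 :=
  Iff.rfl

theorem blockLevi_index (c : Composition n) (F : Type*) [Field F] :
    blockLevi c.index F = levi c F :=
  Subgroup.ext fun _ => (mem_levi_iff c F).symm

theorem blockLevi_mono {γ : Type*} [LinearOrder γ] {a : Fin n → γ} {b : Fin n → β}
    (hab : ∀ i j, b i = b j → a i = a j) (F : Type*) [Field F] :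
    blockLevi b F ≤ blockLevi a F :=
  fun _ hg i j hij => hg i j (mt (hab i j) hij)

end Levi

section RankOne

variable {ι : Type*} [Fintype ι] [DecidableEq ι] {F : Type*} [Field F] {u w : ι → F}

/-- The unipotent element `1 + u wᵀ` for `wᵀ u = 0`; its inverse is `1 - u wᵀ`. With `u` or `w` a
coordinate vector it performs the row and column operations that clear a row or a column. -/
def rankOneUnipotent (u w : ι → F) (h : w ⬝ᵥ u = 0) : GL ι F where
  val := 1 + Matrix.vecMulVec u w
  inv := 1 - Matrix.vecMulVec u w
  val_inv := by
    rw [add_mul, one_mul, mul_sub, mul_one, Matrix.vecMulVec_mul_vecMulVec, h]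
    simp
  inv_val := by
    rw [sub_mul, one_mul, mul_add, mul_one, Matrix.vecMulVec_mul_vecMulVec, h]
    simp

theorem rankOneUnipotent_apply (h : w ⬝ᵥ u = 0) (i j : ι) :
    rankOneUnipotent u w h i j = (1 : Matrix ι ι F) i j + u i * w j := rfl

theorem inv_rankOneUnipotent_apply (h : w ⬝ᵥ u = 0) (i j : ι) :
    (rankOneUnipotent u w h)⁻¹ i j = (1 : Matrix ι ι F) i j - u i * w j := rfl

theorem rankOneUnipotent_single_mul_apply (J : ι) (h : Pi.single J 1 ⬝ᵥ u = 0) (g : GL ι F)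
    (i j : ι) : (rankOneUnipotent u (Pi.single J 1) h * g) i j = g i j + u i * g J j := by
  change ((1 + Matrix.vecMulVec u (Pi.single J 1)) * g.val) i j = _
  rw [add_mul, one_mul, Matrix.vecMulVec_mul, Matrix.add_apply, Matrix.vecMulVec_apply,
    Matrix.single_one_vecMul, Matrix.row_apply]

theorem mul_rankOneUnipotent_single_apply (J : ι) (h : w ⬝ᵥ Pi.single J 1 = 0) (g : GL ι F)
    (i j : ι) : (g * rankOneUnipotent (Pi.single J 1) w h) i j = g i j + g i J * w j := by
  change (g.val * (1 + Matrix.vecMulVec (Pi.single J 1) w)) i j = _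
  rw [mul_add, mul_one, Matrix.mul_vecMulVec, Matrix.add_apply, Matrix.vecMulVec_apply,
    Matrix.mulVec_single_one, Matrix.col_apply]

end RankOne

section CompactLevi

variable {n : ℕ} {F : Type*} [NontriviallyNormedField F] [IsUltrametricDist F]

theorem norm_apply_le_one_of_mem_maximalCompact {k : GL (Fin n) F} (hk : k ∈ maximalCompact n F)
    (i j : Fin n) : ‖k i j‖ ≤ 1 := by
  obtain ⟨g, rfl⟩ := hk
  exact mem_integers_iff.1 (g i j).2

theorem mem_maximalCompact_of_norm_le_one {k : GL (Fin n) F} (h : ∀ i j, ‖k i j‖ ≤ 1)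
    (h' : ∀ i j, ‖(k⁻¹ : GL (Fin n) F) i j‖ ≤ 1) : k ∈ maximalCompact n F := by
  let A : Matrix (Fin n) (Fin n) (integers F) :=
    Matrix.of fun i j => ⟨k i j, mem_integers_iff.2 (h i j)⟩
  let B : Matrix (Fin n) (Fin n) (integers F) :=
    Matrix.of fun i j => ⟨(k⁻¹ : GL (Fin n) F) i j, mem_integers_iff.2 (h' i j)⟩
  have hinj : Function.Injective ((integers F).subtype.mapMatrix (m := Fin n)) :=
    Matrix.map_injective Subtype.val_injective
  have hA : (integers F).subtype.mapMatrix A = k.val := rfl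
  have hB : (integers F).subtype.mapMatrix B = k⁻¹.val := rfl
  refine ⟨⟨A, B, hinj ?_, hinj ?_⟩, Units.ext hA⟩
  · rw [map_mul, hA, hB, map_one, Units.mul_inv]
  · rw [map_mul, hA, hB, map_one, Units.inv_mul]

variable {β : Type*} [LinearOrder β] {b : Fin n → β}

/-- The subgroup `M(𝒪_F)` of the block diagonal group `M(F) = blockLevi b F`. -/
def compactLevi (b : Fin n → β) (F : Type*) [NontriviallyNormedField F] [IsUltrametricDist F] :
    Subgroup (GL (Fin n) F) :=
  maximalCompact n F ⊓ blockLevi b F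

theorem compactLevi_mono {γ : Type*} [LinearOrder γ] {a : Fin n → γ}
    (hab : ∀ i j, b i = b j → a i = a j) (F : Type*) [NontriviallyNormedField F]
    [IsUltrametricDist F] : compactLevi b F ≤ compactLevi a F :=
  inf_le_inf_left _ (blockLevi_mono hab F)

theorem rankOneUnipotent_mem_compactLevi {u w : Fin n → F} (h : w ⬝ᵥ u = 0)
    (hnorm : ∀ i j, ‖u i * w j‖ ≤ 1) (hb : ∀ i j, b i ≠ b j → u i * w j = 0) :
    rankOneUnipotent u w h ∈ compactLevi b F := by
  have hone (i j : Fin n) : ‖(1 : Matrix (Fin n) (Fin n) F) i j‖ ≤ 1 := by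
    rw [Matrix.one_apply]
    split_ifs <;> simp
  refine ⟨mem_maximalCompact_of_norm_le_one (fun i j => ?_) fun i j => ?_, fun i j hij => ?_⟩
  · rw [rankOneUnipotent_apply]
    exact (IsUltrametricDist.norm_add_le_max _ _).trans (max_le (hone i j) (hnorm i j))
  · rw [inv_rankOneUnipotent_apply, sub_eq_add_neg]
    exact (IsUltrametricDist.norm_add_le_max _ _).trans
      (max_le (hone i j) ((norm_neg _).trans_le (hnorm i j)))
  · rw [rankOneUnipotent_apply, hb i j hij, Matrix.one_apply_ne (ne_of_apply_ne b hij), add_zero]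

theorem exists_swap_mem_compactLevi {i j : Fin n} (hij : b i = b j) :
    ∃ k ∈ compactLevi b F, k.val = Matrix.swap F i j := by
  let k : GL (Fin n) F := ⟨Matrix.swap F i j, Matrix.swap F i j, Matrix.swap_mul_self i j,
    Matrix.swap_mul_self i j⟩
  have hnorm (a d : Fin n) : ‖Matrix.swap F i j a d‖ ≤ 1 := by
    rw [Matrix.swap, Equiv.Perm.permMatrix, PEquiv.toMatrix_apply]
    split_ifs <;> simp
  refine ⟨k, ⟨mem_maximalCompact_of_norm_le_one hnorm hnorm, fun a d had => ?_⟩, rfl⟩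
  have hb : b (Equiv.swap i j a) = b a := by
    rw [Equiv.swap_apply_def]
    split_ifs with h h' <;> simp [*]
  change Matrix.swap F i j a d = 0
  rw [Matrix.swap, Equiv.Perm.permMatrix, PEquiv.toMatrix_apply]
  exact if_neg fun h => had (by simpa [← hb] using congrArg b (Option.some_inj.1 h))

end CompactLevi

section Pivot

variable {n : ℕ} {F : Type*} [NontriviallyNormedField F] [IsUltrametricDist F]
  {β : Type*} [LinearOrder β] {b : Fin n → β} {J : Fin n} {S : Set (GL (Fin n) F)}

theorem norm_apply_le_of_swap_stable {C : ℝ} (hmax : ∀ h ∈ S, ‖h J J‖ ≤ C)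
    (hleft : ∀ k ∈ compactLevi b F, ∀ g ∈ S, k * g ∈ S)
    (hright : ∀ k ∈ compactLevi b F, ∀ g ∈ S, g * k ∈ S) {h : GL (Fin n) F} (hh : h ∈ S)
    {k : Fin n} (hk : b k = b J) : ‖h J k‖ ≤ C ∧ ‖h k J‖ ≤ C := by
  obtain ⟨σ, hσ, hval⟩ := exists_swap_mem_compactLevi (F := F) hk
  constructor
  · have hrow := hmax _ (hright σ hσ h hh)
    rwa [Units.val_mul, hval, Matrix.mul_swap_apply_right] at hrow
  · have hcol := hmax _ (hleft σ hσ h hh)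
    rwa [Units.val_mul, hval, Matrix.swap_mul_apply_right] at hcol

theorem exists_clear_column {g : GL (Fin n) F} (hg : g ∈ blockLevi b F) (hJ : g J J ≠ 0)
    (hle : ∀ i, b i = b J → ‖g i J‖ ≤ ‖g J J‖) :
    ∃ k ∈ compactLevi b F, (∀ j, (k * g) J j = g J j) ∧ ∀ i ≠ J, (k * g) i J = 0 := by
  let u : Fin n → F := fun i => if i = J then 0 else -g i J / g J J
  have hu (i : Fin n) : ‖u i‖ ≤ 1 ∧ (b i ≠ b J → u i = 0) := by
    by_cases hb : b i = b J
    · refine ⟨?_, absurd hb⟩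
      by_cases hi : i = J
      · simp [u, hi]
      · simpa [u, hi] using div_le_one_of_le₀ (hle i hb) (norm_nonneg _)
    · have h0 : u i = 0 := by simp [u, mem_blockLevi_iff.1 hg i J hb]
      simp [h0]
  have huJ : Pi.single J 1 ⬝ᵥ u = 0 := by simp [u]
  refine ⟨rankOneUnipotent u (Pi.single J 1) huJ,
    rankOneUnipotent_mem_compactLevi _ (fun i j => ?_) fun i j hij => ?_, fun j => ?_,
    fun i hi => ?_⟩
  · obtain rfl | hj := eq_or_ne j J
    · simpa using (hu i).1
    · simp [hj]
  · obtain rfl | hj := eq_or_ne j J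
    · simpa using (hu i).2 hij
    · simp [hj]
  · simp [rankOneUnipotent_single_mul_apply, u]
  · simp [rankOneUnipotent_single_mul_apply, u, hi, hJ]

theorem exists_clear_row {g : GL (Fin n) F} (hg : g ∈ blockLevi b F) (hJ : g J J ≠ 0)
    (hle : ∀ j, b j = b J → ‖g J j‖ ≤ ‖g J J‖) :
    ∃ k ∈ compactLevi b F, (∀ i, (g * k) i J = g i J) ∧ ∀ j ≠ J, (g * k) J j = 0 := by
  let w : Fin n → F := fun j => if j = J then 0 else -g J j / g J J
  have hw (j : Fin n) : ‖w j‖ ≤ 1 ∧ (b J ≠ b j → w j = 0) := by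
    by_cases hb : b j = b J
    · refine ⟨?_, absurd hb.symm⟩
      by_cases hj : j = J
      · simp [w, hj]
      · simpa [w, hj] using div_le_one_of_le₀ (hle j hb) (norm_nonneg _)
    · have h0 : w j = 0 := by simp [w, mem_blockLevi_iff.1 hg J j (Ne.symm hb)]
      simp [h0]
  have hwJ : w ⬝ᵥ Pi.single J 1 = 0 := by simp [w]
  refine ⟨rankOneUnipotent (Pi.single J 1) w hwJ,
    rankOneUnipotent_mem_compactLevi _ (fun i j => ?_) fun i j hij => ?_, fun i => ?_,
    fun j hj => ?_⟩
  · obtain rfl | hi := eq_or_ne i J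
    · simpa using (hw j).1
    · simp [hi]
  · obtain rfl | hi := eq_or_ne i J
    · simpa using (hw j).2 hij
    · simp [hi]
  · simp [mul_rankOneUnipotent_single_apply, w]
  · simp [mul_rankOneUnipotent_single_apply, w, hj, mul_div_cancel₀, hJ]

theorem exists_pivot [ProperSpace F] (hne : S.Nonempty) (hS : S ⊆ blockLevi b F)
    (hleft : ∀ k ∈ compactLevi b F, ∀ g ∈ S, k * g ∈ S)
    (hright : ∀ k ∈ compactLevi b F, ∀ g ∈ S, g * k ∈ S) {C : ℝ} (hC : ∀ g ∈ S, ‖g J J‖ ≤ C) :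
    ∃ g ∈ S, g J J ≠ 0 ∧ (∀ i ≠ J, g i J = 0) ∧ (∀ j ≠ J, g J j = 0) ∧
      ∀ h ∈ S, ∀ k, b k = b J → ‖h J k‖ ≤ ‖g J J‖ := by
  obtain ⟨_, ⟨g, hg, rfl⟩, hmax⟩ := exists_isMaxOn_norm_of_isBounded
    (hne.image fun g : GL (Fin n) F => g J J)
    (isBounded_iff_forall_norm_le.2 ⟨C, Set.forall_mem_image.2 hC⟩)
  have hle {h : GL (Fin n) F} (hh : h ∈ S) {k : Fin n} (hk : b k = b J) :=
    norm_apply_le_of_swap_stable (Set.forall_mem_image.1 hmax) hleft hright hh hk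
  have hJ : g J J ≠ 0 := by
    intro h0
    refine Matrix.GeneralLinearGroup.det_ne_zero g (Matrix.det_eq_zero_of_row_eq_zero J fun j => ?_)
    by_cases hj : b j = b J
    · simpa [h0] using (hle hg hj).1
    · exact hS hg J j (Ne.symm hj)
  obtain ⟨k₁, hk₁, hrow₁, hcol₁⟩ := exists_clear_column (hS hg) hJ fun i hi => (hle hg hi).2
  have hg₁ := hleft k₁ hk₁ g hg
  obtain ⟨k₂, hk₂, hcol₂, hrow₂⟩ := exists_clear_row (hS hg₁) (hrow₁ J ▸ hJ) fun j hj => by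
    simpa only [hrow₁] using (hle hg hj).1
  have hJ₂ : (k₁ * g * k₂) J J = g J J := (hcol₂ J).trans (hrow₁ J)
  exact ⟨k₁ * g * k₂, hright k₂ hk₂ _ hg₁, hJ₂ ▸ hJ, fun i hi => (hcol₂ i).trans (hcol₁ i hi),
    hrow₂, fun h hh k hk => hJ₂ ▸ (hle hh hk).1⟩

end Pivot

section UpperUnipotent

variable {n : ℕ}

/-- The positions `(i, j)` strictly above the diagonal. -/
abbrev UpperIndex (n : ℕ) : Type := {ij : Fin n × Fin n // ij.1 < ij.2}

section Field

variable {F : Type*} [Field F] {s : Finset (UpperIndex n)}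

/-- The strictly upper triangular matrix with entries `x` at the positions in `s` and `0`
elsewhere. -/
def upperMatrix (s : Finset (UpperIndex n)) (F : Type*) [Field F] :
    (s → F) →ₗ[F] Matrix (Fin n) (Fin n) F where
  toFun x := Matrix.of fun i j =>
    if h : ∃ hij : i < j, (⟨(i, j), hij⟩ : UpperIndex n) ∈ s then x ⟨⟨(i, j), h.1⟩, h.2⟩ else 0
  map_add' x y := by
    ext i j
    by_cases h : ∃ hij : i < j, (⟨(i, j), hij⟩ : UpperIndex n) ∈ s <;> simp [h]
  map_smul' a x := by
    ext i j
    by_cases h : ∃ hij : i < j, (⟨(i, j), hij⟩ : UpperIndex n) ∈ s <;> simp [h]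

theorem upperMatrix_apply (x : s → F) (p : s) :
    upperMatrix s F x p.1.1.1 p.1.1.2 = x p :=
  dif_pos ⟨p.1.2, p.2⟩

theorem upperMatrix_apply_eq_zero (x : s → F) {i j : Fin n} (h : ∀ p ∈ s, p.1 ≠ (i, j)) :
    upperMatrix s F x i j = 0 :=
  dif_neg fun ⟨_, hs⟩ => h _ hs rfl

theorem upperMatrix_apply_of_le (x : s → F) {i j : Fin n} (h : j ≤ i) :
    upperMatrix s F x i j = 0 :=
  dif_neg fun ⟨hij, _⟩ => h.not_gt hij

theorem upperMatrix_piFinsetUnion [MeasurableSpace F] {t : Finset (UpperIndex n)}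
    (h : Disjoint s t) (x : s → F) (y : t → F) :
    upperMatrix (s ∪ t) F (MeasurableEquiv.piFinsetUnion (fun _ => F) h (x, y)) =
      upperMatrix s F x + upperMatrix t F y := by
  ext i j
  by_cases hst : ∃ hij : i < j, (⟨(i, j), hij⟩ : UpperIndex n) ∈ s ∪ t
  · obtain ⟨hij, hst⟩ := hst
    refine (upperMatrix_apply _ ⟨⟨(i, j), hij⟩, hst⟩).trans ?_
    rw [Matrix.add_apply]
    rcases Finset.mem_union.1 hst with hs | ht
    · rw [upperMatrix_apply_eq_zero y (i := i) (j := j) fun p hp hpij =>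
        Finset.disjoint_left.1 h hs (by simpa [← hpij] using hp), add_zero]
      exact (Equiv.piFinsetUnion_left (fun _ => F) h hs hst).trans
        (upperMatrix_apply x ⟨_, hs⟩).symm
    · rw [upperMatrix_apply_eq_zero x (i := i) (j := j) fun p hp hpij =>
        Finset.disjoint_left.1 h hp (by simpa [← hpij] using ht), zero_add]
      exact (Equiv.piFinsetUnion_right (fun _ => F) h ht hst).trans
        (upperMatrix_apply y ⟨_, ht⟩).symm
  · have hzero {u : Finset (UpperIndex n)} (hu : u ⊆ s ∪ t) (z : u → F) :
        upperMatrix u F z i j = 0 :=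
      dif_neg fun ⟨hij, hmem⟩ => hst ⟨hij, hu hmem⟩
    rw [Matrix.add_apply, hzero subset_rfl, hzero Finset.subset_union_left,
      hzero Finset.subset_union_right, add_zero]

theorem det_one_add_upperMatrix (x : s → F) : (1 + upperMatrix s F x).det = 1 := by
  rw [Matrix.det_of_isUpperTriangular]
  · exact Finset.prod_eq_one fun i _ => by simp [upperMatrix_apply_of_le x le_rfl]
  · intro i j (hij : j < i)
    simp [upperMatrix_apply_of_le x hij.le, Matrix.one_apply_ne hij.ne']

/-- The element `1 + X` of the group of unipotent upper triangular matrices, where `X` has the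
entries `x` at the positions in `s`. -/
def upperUnipotent (s : Finset (UpperIndex n)) (x : s → F) : GL (Fin n) F :=
  Matrix.GeneralLinearGroup.mkOfDetNeZero (1 + upperMatrix s F x)
    (by rw [det_one_add_upperMatrix]; exact one_ne_zero)

theorem val_upperUnipotent (x : s → F) : (upperUnipotent s x).val = 1 + upperMatrix s F x := rfl

theorem upperUnipotent_apply_self (x : s → F) (i : Fin n) : upperUnipotent s x i i = 1 := by
  simp [val_upperUnipotent, upperMatrix_apply_of_le x le_rfl]

theorem upperUnipotent_apply_of_lt (x : s → F) {i j : Fin n} (h : j < i) :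
    upperUnipotent s x i j = 0 := by
  simp [val_upperUnipotent, upperMatrix_apply_of_le x h.le, Matrix.one_apply_ne h.ne']

end Field

section Norm

variable {F : Type*} [NontriviallyNormedField F]

theorem norm_upperMatrix_apply_le {s : Finset (UpperIndex n)} (x : s → F) {i j : Fin n} {C : ℝ}
    (hC : 0 ≤ C) (h : ∀ p : s, p.1.1 = (i, j) → ‖x p‖ ≤ C) : ‖upperMatrix s F x i j‖ ≤ C := by
  by_cases hij : ∃ p : s, p.1.1 = (i, j)
  · obtain ⟨p, hp⟩ := hij
    have hxp := upperMatrix_apply x p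
    simp only [hp] at hxp
    exact hxp ▸ h p hp
  · rw [upperMatrix_apply_eq_zero x fun p hp hpij => hij ⟨⟨p, hp⟩, hpij⟩, norm_zero]
    exact hC

theorem continuous_upperUnipotent (s : Finset (UpperIndex n)) :
    Continuous (upperUnipotent s : (s → F) → GL (Fin n) F) := by
  have hval : Continuous fun x : s → F => (upperUnipotent s x).val :=
    continuous_const.add (LinearMap.continuous_on_pi (upperMatrix s F))
  refine Units.continuous_iff.2 ⟨hval, ?_⟩
  have hinv (x : s → F) : (upperUnipotent s x)⁻¹.val = (upperUnipotent s x).val.adjugate := by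
    rw [Matrix.coe_units_inv, Matrix.inv_def, val_upperUnipotent, det_one_add_upperMatrix,
      Ring.inverse_one, one_smul]
  simp_rw [hinv]
  exact hval.matrix_adjugate

theorem hasCompactSupport_comp_upperUnipotent {f : GL (Fin n) F → ℂ} (hf : HasCompactSupport f)
    (g : GL (Fin n) F) (s : Finset (UpperIndex n)) :
    HasCompactSupport fun x : s → F => f (g * upperUnipotent s x) := by
  have hcont : Continuous fun (h : GL (Fin n) F) (p : s) => (g⁻¹ * h).val p.1.1.1 p.1.1.2 :=
    continuous_pi fun p =>
      (Units.continuous_val.comp (continuous_const.mul continuous_id)).matrix_elem _ _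
  refine HasCompactSupport.intro (hf.isCompact.image hcont) fun x hx => ?_
  by_contra h
  refine hx ⟨g * upperUnipotent s x, subset_tsupport _ h, funext fun p => ?_⟩
  simp only [inv_mul_cancel_left, val_upperUnipotent, Matrix.add_apply]
  rw [upperMatrix_apply, Matrix.one_apply_ne p.1.2.ne, zero_add]

end Norm

end UpperUnipotent

section Positions

variable {n : ℕ} {β : Type*} [LinearOrder β]

/-- The positions strictly above the diagonal blocks cut out by `b`. For `b = c.index` these are the
coordinates of the unipotent radical. -/
def nilPositions (b : Fin n → β) : Finset (UpperIndex n) :=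
  Finset.univ.filter fun p => b p.1.1 < b p.1.2

/-- The positions in the row `J` to the right of the diagonal that lie in the diagonal block
containing `J`. -/
def rowPositions (b : Fin n → β) (J : Fin n) : Finset (UpperIndex n) :=
  Finset.univ.filter fun p => p.1.1 = J ∧ b p.1.2 = b J

variable {b : Fin n → β} {J : Fin n}

theorem mem_nilPositions {p : UpperIndex n} : p ∈ nilPositions b ↔ b p.1.1 < b p.1.2 := by
  simp [nilPositions]

theorem mem_rowPositions {p : UpperIndex n} :
    p ∈ rowPositions b J ↔ p.1.1 = J ∧ b p.1.2 = b J := by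
  simp [rowPositions]

theorem disjoint_nilPositions_rowPositions : Disjoint (nilPositions b) (rowPositions b J) :=
  Finset.disjoint_left.2 fun p hp hp' => by
    obtain ⟨hJ, hb⟩ := mem_rowPositions.1 hp'
    exact (mem_nilPositions.1 hp).ne (by rw [hJ, hb])

section Field

variable {F : Type*} [Field F]

theorem upperMatrix_nilPositions_apply_eq_zero (x : nilPositions b → F) {i j : Fin n}
    (h : ¬ b i < b j) : upperMatrix (nilPositions b) F x i j = 0 :=
  upperMatrix_apply_eq_zero x fun p hp hij => h (by simpa [hij] using mem_nilPositions.1 hp)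

theorem mul_upperMatrix_mul_apply_eq_zero {P Q : GL (Fin n) F} (hP : P ∈ blockLevi b F)
    (hQ : Q ∈ blockLevi b F) (x : nilPositions b → F) {i j : Fin n} (h : ¬ b i < b j) :
    (P.val * upperMatrix (nilPositions b) F x * Q.val) i j = 0 := by
  simp only [Matrix.mul_apply]
  refine Finset.sum_eq_zero fun l _ => ?_
  by_cases hl : b l = b j
  · rw [Finset.sum_eq_zero fun k _ => ?_, zero_mul]
    by_cases hk : b i = b k
    · rw [upperMatrix_nilPositions_apply_eq_zero x (hl ▸ hk ▸ h), mul_zero]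
    · rw [mem_blockLevi_iff.1 hP i k hk, zero_mul]
  · rw [mem_blockLevi_iff.1 hQ l j hl, mul_zero]

/-- The map `X ↦ P X Q` in the coordinates `nilPositions b`. For block diagonal `P` and `Q` and
monotone `b` no entry of `P X Q` is lost. -/
def nilMul (b : Fin n → β) (P Q : GL (Fin n) F) :
    (nilPositions b → F) →ₗ[F] (nilPositions b → F) where
  toFun x p := (P.val * upperMatrix (nilPositions b) F x * Q.val) p.1.1.1 p.1.1.2
  map_add' x y := by
    ext p
    simp [mul_add, add_mul]
  map_smul' a x := by
    ext p
    simp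

theorem upperMatrix_nilMul (hb : Monotone b) {P Q : GL (Fin n) F} (hP : P ∈ blockLevi b F)
    (hQ : Q ∈ blockLevi b F) (x : nilPositions b → F) :
    upperMatrix (nilPositions b) F (nilMul b P Q x) =
      P.val * upperMatrix (nilPositions b) F x * Q.val := by
  ext i j
  by_cases h : b i < b j
  · exact upperMatrix_apply _ ⟨⟨(i, j), hb.reflect_lt h⟩, mem_nilPositions.2 h⟩
  · rw [upperMatrix_nilPositions_apply_eq_zero _ h, mul_upperMatrix_mul_apply_eq_zero hP hQ x h]

theorem nilMul_inv_nilMul (hb : Monotone b) {P Q : GL (Fin n) F} (hP : P ∈ blockLevi b F)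
    (hQ : Q ∈ blockLevi b F) (x : nilPositions b → F) :
    nilMul b P⁻¹ Q⁻¹ (nilMul b P Q x) = x := by
  funext p
  change (P⁻¹.val * upperMatrix _ F (nilMul b P Q x) * Q⁻¹.val) p.1.1.1 p.1.1.2 = _
  rw [upperMatrix_nilMul hb hP hQ, ← upperMatrix_apply x p]
  simp [mul_assoc]

/-- The automorphism `X ↦ P X Q` of the space of matrices supported above the diagonal blocks, for
block diagonal `P` and `Q`. -/
def nilMulEquiv (hb : Monotone b) {P Q : GL (Fin n) F} (hP : P ∈ blockLevi b F)
    (hQ : Q ∈ blockLevi b F) : (nilPositions b → F) ≃ₗ[F] (nilPositions b → F) :=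
  LinearEquiv.ofLinearMap (nilMul b P Q) (nilMul b P⁻¹ Q⁻¹)
    (LinearMap.ext fun x => by
      simpa using nilMul_inv_nilMul hb (inv_mem hP) (inv_mem hQ) x)
    (LinearMap.ext fun x => nilMul_inv_nilMul hb hP hQ x)

theorem upperUnipotent_rowPositions (x : rowPositions b J → F) :
    upperUnipotent (rowPositions b J) x =
      rankOneUnipotent (Pi.single J 1) (upperMatrix (rowPositions b J) F x J)
        (by simp [upperMatrix_apply_of_le x le_rfl]) := by
  refine Units.ext (congrArg (1 + ·) (Matrix.ext fun i j => ?_))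
  obtain rfl | hi := eq_or_ne i J
  · simp [Matrix.vecMulVec_apply]
  · rw [Matrix.vecMulVec_apply, Pi.single_eq_of_ne hi, zero_mul]
    exact upperMatrix_apply_eq_zero x fun p hp hij =>
      hi (by simpa [hij] using (mem_rowPositions.1 hp).1)

theorem upperUnipotent_rowPositions_mem_blockLevi (x : rowPositions b J → F) :
    upperUnipotent (rowPositions b J) x ∈ blockLevi b F := fun i j hij => by
  rw [val_upperUnipotent, Matrix.add_apply, Matrix.one_apply_ne (ne_of_apply_ne b hij), zero_add]
  refine upperMatrix_apply_eq_zero x fun p hp hpij => hij ?_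
  have := mem_rowPositions.1 hp
  simp only [hpij] at this
  rw [this.1, this.2]

theorem mul_upperUnipotent_nilPositions (hb : Monotone b) {P : GL (Fin n) F}
    (hP : P ∈ blockLevi b F) (x : nilPositions b → F) :
    P * upperUnipotent (nilPositions b) x =
      upperUnipotent (nilPositions b) (nilMulEquiv hb hP (inv_mem hP) x) * P := by
  have hval : upperMatrix (nilPositions b) F (nilMulEquiv hb hP (inv_mem hP) x) =
      P.val * upperMatrix (nilPositions b) F x * P⁻¹.val :=
    upperMatrix_nilMul hb hP (inv_mem hP) x
  refine Units.ext ?_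
  rw [Units.val_mul, Units.val_mul, val_upperUnipotent, val_upperUnipotent, hval]
  simp [mul_add, add_mul, mul_assoc]

theorem upperUnipotent_rowPositions_mul [MeasurableSpace F] (hb : Monotone b)
    (x : nilPositions b → F) (v : rowPositions b J → F) :
    upperUnipotent (rowPositions b J) v * upperUnipotent (nilPositions b) x =
      upperUnipotent (nilPositions b ∪ rowPositions b J)
        (MeasurableEquiv.piFinsetUnion (fun _ => F) disjoint_nilPositions_rowPositions
          (nilMulEquiv hb (upperUnipotent_rowPositions_mem_blockLevi v) (one_mem _) x, v)) := by
  have hval : upperMatrix (nilPositions b) F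
      (nilMulEquiv hb (upperUnipotent_rowPositions_mem_blockLevi v) (one_mem _) x) =
        (upperUnipotent (rowPositions b J) v).val * upperMatrix (nilPositions b) F x :=
    (upperMatrix_nilMul hb (upperUnipotent_rowPositions_mem_blockLevi v) (one_mem _) x).trans
      (mul_one _)
  refine Units.ext ?_
  rw [Units.val_mul, val_upperUnipotent, val_upperUnipotent, val_upperUnipotent,
    upperMatrix_piFinsetUnion, hval, val_upperUnipotent]
  noncomm_ring

end Field

section Norm

variable {F : Type*} [NontriviallyNormedField F] [IsUltrametricDist F]

theorem norm_nilMul_apply_le {P Q : GL (Fin n) F} {w : Fin n → ℝ} (hw : ∀ i, 0 ≤ w i)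
    (hP : ∀ i k, ‖P i k‖ * w k ≤ w i) (hQ : ∀ i j, ‖Q i j‖ ≤ 1) {x : nilPositions b → F}
    (hx : ∀ p, ‖x p‖ ≤ w p.1.1.1) (p : nilPositions b) : ‖nilMul b P Q x p‖ ≤ w p.1.1.1 := by
  have hX (i j : Fin n) : ‖upperMatrix (nilPositions b) F x i j‖ ≤ w i :=
    norm_upperMatrix_apply_le x (hw i) fun p hp => by simpa [hp] using hx p
  change ‖(P.val * upperMatrix (nilPositions b) F x * Q.val) p.1.1.1 p.1.1.2‖ ≤ _
  refine norm_matrix_mul_apply_le (hw _) fun l => ?_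
  refine (mul_le_of_le_one_right (norm_nonneg _) (hQ _ _)).trans ?_
  exact norm_matrix_mul_apply_le (hw _) fun k =>
    (mul_le_mul_of_nonneg_left (hX k l) (norm_nonneg _)).trans (hP _ k)

theorem upperUnipotent_rowPositions_mem_compactLevi {v : rowPositions b J → F} (hv : ‖v‖ ≤ 1) :
    upperUnipotent (rowPositions b J) v ∈ compactLevi b F := by
  have hblock := upperUnipotent_rowPositions_mem_blockLevi v
  rw [upperUnipotent_rowPositions] at hblock ⊢
  refine rankOneUnipotent_mem_compactLevi _ (fun i j => ?_) fun i j hij => ?_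
  · have hw : ‖upperMatrix (rowPositions b J) F v J j‖ ≤ 1 :=
      norm_upperMatrix_apply_le v zero_le_one fun p _ => (norm_le_pi_norm v p).trans hv
    obtain rfl | hi := eq_or_ne i J
    · simpa using hw
    · simp [hi]
  · simpa [rankOneUnipotent_apply, Matrix.one_apply_ne (ne_of_apply_ne b hij)] using
      hblock i j hij

end Norm

end Positions

section Composition

variable {n : ℕ} {F : Type*} [Field F]

theorem monotone_index (c : Composition n) : Monotone c.index :=
  fun _ _ => index_mono

/-- The positions of the entries of the Lie algebra `𝔫`, as positions above the diagonal. -/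
def nilIndexEquiv (c : Composition n) : NilIndex c ≃ nilPositions c.index where
  toFun p := ⟨⟨p.1, (monotone_index c).reflect_lt p.2⟩, mem_nilPositions.2 p.2⟩
  invFun p := ⟨p.1.1, mem_nilPositions.1 p.2⟩
  left_inv _ := rfl
  right_inv _ := rfl

theorem nilMatrix_comp_nilIndexEquiv (c : Composition n) (x : nilPositions c.index → F) :
    nilMatrix c F (x ∘ nilIndexEquiv c) = upperMatrix (nilPositions c.index) F x := by
  ext i j
  by_cases h : c.index i < c.index j
  · exact (dif_pos h).trans (upperMatrix_apply x (nilIndexEquiv c ⟨(i, j), h⟩)).symm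
  · exact (dif_neg h).trans (upperMatrix_nilPositions_apply_eq_zero x h).symm

end Composition

section Haar

open MeasureTheory

variable {n : ℕ} {F : Type*} [NontriviallyNormedField F] [ProperSpace F] [MeasurableSpace F]
  [BorelSpace F]

instance : (haarF F).IsAddHaarMeasure := by
  unfold haarF
  infer_instance

theorem measurePreserving_of_box {ι : Type*} [Finite ι] (μ : Measure (ι → F))
    [μ.IsAddHaarMeasure] (L : (ι → F) ≃ₗ[F] (ι → F)) {r : ι → ℝ} (hr : ∀ i, 0 < r i)
    (h : ∀ x, (∀ i, ‖x i‖ ≤ r i) → ∀ i, ‖L x i‖ ≤ r i)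
    (h' : ∀ x, (∀ i, ‖x i‖ ≤ r i) → ∀ i, ‖L.symm x i‖ ≤ r i) :
    MeasurePreserving L μ μ := by
  have hL : Continuous L := LinearMap.continuous_on_pi L.toLinearMap
  have hL' : Continuous L.symm := LinearMap.continuous_on_pi L.symm.toLinearMap
  let K : TopologicalSpace.PositiveCompacts (ι → F) :=
    { carrier := Set.univ.pi fun i => Metric.closedBall 0 (r i)
      isCompact' := isCompact_univ_pi fun i => isCompact_closedBall _ _
      interior_nonempty' := by
        refine ⟨0, ?_⟩
        rw [interior_pi_set Set.finite_univ]
        exact fun i _ => Metric.ball_subset_interior_closedBall (Metric.mem_ball_self (hr i)) }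
  have hmem (x : ι → F) : x ∈ (K : Set (ι → F)) ↔ ∀ i, ‖x i‖ ≤ r i := by
    change x ∈ Set.univ.pi (fun i => Metric.closedBall (0 : F) (r i)) ↔ _
    simp
  have hK : L ⁻¹' K = K := by
    ext x
    rw [Set.mem_preimage, hmem, hmem]
    exact ⟨fun hx => by simpa using h' _ hx, h x⟩
  have : (μ.map L).IsAddHaarMeasure := AddEquiv.isAddHaarMeasure_map μ L.toAddEquiv hL hL'
  refine ⟨hL.measurable, ?_⟩
  rw [Measure.addHaarMeasure_unique (μ.map L) K, Measure.map_apply hL.measurable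
    K.isCompact.measurableSet, hK]
  exact (Measure.addHaarMeasure_unique μ K).symm

variable [IsUltrametricDist F] {β : Type*} [LinearOrder β] {b : Fin n → β}

-- If `P` and `P⁻¹` preserve the box `‖x_i‖ ≤ w_i` of `F^n`, then `X ↦ P X Q` preserves the lattice
-- of matrices whose columns lie in that box.
theorem measurePreserving_nilMulEquiv (hb : Monotone b) {P Q : GL (Fin n) F}
    (hP : P ∈ blockLevi b F) (hQ : Q ∈ compactLevi b F) {w : Fin n → ℝ} (hw : ∀ i, 0 < w i)
    (h : ∀ i k, ‖P i k‖ * w k ≤ w i) (h' : ∀ i k, ‖(P⁻¹ : GL (Fin n) F) i k‖ * w k ≤ w i) :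
    MeasurePreserving (nilMulEquiv hb hP hQ.2) (Measure.pi fun _ => haarF F)
      (Measure.pi fun _ => haarF F) :=
  measurePreserving_of_box _ _ (r := fun p => w p.1.1.1) (fun p => hw p.1.1.1)
    (fun _ => norm_nilMul_apply_le (fun i => (hw i).le) h
      (norm_apply_le_one_of_mem_maximalCompact hQ.1))
    (fun _ => norm_nilMul_apply_le (fun i => (hw i).le) h'
      (norm_apply_le_one_of_mem_maximalCompact (inv_mem hQ.1)))

theorem measurePreserving_nilMulEquiv_conj (hb : Monotone b) {k : GL (Fin n) F}
    (hk : k ∈ compactLevi b F) :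
    MeasurePreserving (nilMulEquiv hb hk.2 (inv_mem hk.2)) (Measure.pi fun _ => haarF F)
      (Measure.pi fun _ => haarF F) :=
  measurePreserving_nilMulEquiv hb hk.2 (inv_mem hk) (w := 1) (fun _ => one_pos)
    (fun i j => by simpa using norm_apply_le_one_of_mem_maximalCompact hk.1 i j)
    fun i j => by simpa using norm_apply_le_one_of_mem_maximalCompact (inv_mem hk.1) i j

theorem measurePreserving_nilMulEquiv_rankOneUnipotent (hb : Monotone b) {J : Fin n}
    {v : Fin n → F} (h : v ⬝ᵥ Pi.single J 1 = 0)
    (hv : rankOneUnipotent (Pi.single J 1) v h ∈ blockLevi b F) :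
    MeasurePreserving (nilMulEquiv hb hv (one_mem _)) (Measure.pi fun _ => haarF F)
      (Measure.pi fun _ => haarF F) := by
  let R := max 1 ‖v‖
  let w : Fin n → ℝ := Function.update 1 J R
  have hvJ : v J = 0 := by simpa using h
  have hw (i : Fin n) : 1 ≤ w i := by
    by_cases hi : i = J <;> simp [w, R, hi]
  have hle {A : Matrix (Fin n) (Fin n) F} (hA : ∀ i k, ‖A i k‖ ≤
      max ‖(1 : Matrix (Fin n) (Fin n) F) i k‖ ‖(Pi.single J 1 : Fin n → F) i * v k‖) (i k) :
      ‖A i k‖ * w k ≤ w i := by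
    obtain rfl | hk := eq_or_ne k i
    · refine mul_le_of_le_one_left (zero_le_one.trans (hw _)) ((hA _ _).trans ?_)
      obtain rfl | hk := eq_or_ne k J <;> simp [*]
    obtain rfl | hi := eq_or_ne i J
    · have : ‖A i k‖ ≤ ‖v k‖ := by simpa [Matrix.one_apply_ne' hk] using hA i k
      have hR : ‖A i k‖ ≤ R := (this.trans (norm_le_pi_norm v k)).trans (le_max_right 1 _)
      simpa [w, hk] using hR
    · have : ‖A i k‖ ≤ 0 := by simpa [hi, Matrix.one_apply_ne' hk] using hA i k
      exact (mul_nonpos_of_nonpos_of_nonneg this (zero_le_one.trans (hw k))).trans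
        (zero_le_one.trans (hw i))
  refine measurePreserving_nilMulEquiv hb hv (one_mem _) (fun i => one_pos.trans_le (hw i))
    (hle fun i k => ?_) (hle fun i k => ?_)
  · exact IsUltrametricDist.norm_add_le_max _ _
  · rw [inv_rankOneUnipotent_apply, sub_eq_add_neg, ← norm_neg (_ * _)]
    exact IsUltrametricDist.norm_add_le_max _ _

end Haar

section Integral

open MeasureTheory

variable {n : ℕ} {F : Type*} [NontriviallyNormedField F] [ProperSpace F] [MeasurableSpace F]
  [BorelSpace F]

/-- The integral of `u ↦ f (g u)` over the unipotent matrices `u` supported at the diagonal and the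
positions in `s`. For `s = nilPositions c.index` it is the constant term of `f` without the factor
`δ_P^{1/2}`. -/
def unipotentIntegral (s : Finset (UpperIndex n)) (f : GL (Fin n) F → ℂ) (g : GL (Fin n) F) : ℂ :=
  ∫ x : s → F, f (g * upperUnipotent s x) ∂Measure.pi fun _ => haarF F

theorem unipotentIntegral_mul_left [IsUltrametricDist F] {s : Finset (UpperIndex n)}
    {f : GL (Fin n) F → ℂ} (hf : IsUnramified f) {k : GL (Fin n) F} (hk : k ∈ maximalCompact n F)
    (g : GL (Fin n) F) : unipotentIntegral s f (k * g) = unipotentIntegral s f g :=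
  integral_congr_ae (.of_forall fun x => by
    simpa [mul_assoc] using hf.biinvariant k hk 1 (one_mem _) (g * upperUnipotent s x))

variable {β : Type*} [LinearOrder β] {b : Fin n → β}

theorem unipotentIntegral_mul_right [IsUltrametricDist F] {f : GL (Fin n) F → ℂ}
    (hf : IsUnramified f) (hb : Monotone b) {k : GL (Fin n) F} (hk : k ∈ compactLevi b F)
    (g : GL (Fin n) F) :
    unipotentIntegral (nilPositions b) f (g * k) = unipotentIntegral (nilPositions b) f g := by
  let e := nilMulEquiv hb hk.2 (inv_mem hk.2)
  have hmp := measurePreserving_nilMulEquiv_conj hb hk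
  refine Eq.trans (integral_congr_ae (.of_forall fun x => ?_))
    (hmp.integral_comp e.toContinuousLinearEquiv.toHomeomorph.measurableEmbedding
      fun x => f (g * upperUnipotent _ x))
  have hright := hf.biinvariant 1 (one_mem _) k hk.1 (g * upperUnipotent _ (e x))
  rw [one_mul, mul_assoc, ← mul_upperUnipotent_nilPositions hb hk.2, ← mul_assoc] at hright
  exact hright

theorem unipotentIntegral_nilPositions_union_rowPositions [IsUltrametricDist F]
    {f : GL (Fin n) F → ℂ} (hf : Continuous f) (hf' : HasCompactSupport f) (hb : Monotone b)
    (J : Fin n) (g : GL (Fin n) F) :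
    unipotentIntegral (nilPositions b ∪ rowPositions b J) f g =
      ∫ v : rowPositions b J → F, unipotentIntegral (nilPositions b) f (g * upperUnipotent _ v)
        ∂Measure.pi fun _ => haarF F := by
  let e := MeasurableEquiv.piFinsetUnion (fun _ => F)
    (disjoint_nilPositions_rowPositions (b := b) (J := J))
  have he : MeasurePreserving e ((Measure.pi fun _ => haarF F).prod (Measure.pi fun _ => haarF F))
      (Measure.pi fun _ => haarF F) := measurePreserving_piFinsetUnion _ fun _ => haarF F
  have hint : Integrable (fun z => f (g * upperUnipotent _ z)) (Measure.pi fun _ => haarF F) :=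
    (hf.comp (continuous_const.mul (continuous_upperUnipotent _))).integrable_of_hasCompactSupport
      (hasCompactSupport_comp_upperUnipotent hf' g (nilPositions b ∪ rowPositions b J))
  have hfibre (v : rowPositions b J → F) :
      ∫ x, f (g * upperUnipotent _ (e (x, v))) ∂Measure.pi (fun _ => haarF F) =
        unipotentIntegral (nilPositions b) f (g * upperUnipotent _ v) := by
    let L := nilMulEquiv hb (upperUnipotent_rowPositions_mem_blockLevi v) (one_mem _)
    have hL : MeasurePreserving L (Measure.pi fun _ => haarF F) (Measure.pi fun _ => haarF F) := by
      have hv := upperUnipotent_rowPositions_mem_blockLevi v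
      simp only [upperUnipotent_rowPositions] at hv
      simpa only [L, upperUnipotent_rowPositions] using
        measurePreserving_nilMulEquiv_rankOneUnipotent hb _ hv
    rw [← hL.integral_comp L.toContinuousLinearEquiv.toHomeomorph.measurableEmbedding]
    simp only [unipotentIntegral, mul_assoc, upperUnipotent_rowPositions_mul hb]
    rfl
  rw [unipotentIntegral, ← he.integral_comp e.measurableEmbedding, integral_prod_symm]
  · exact integral_congr_ae (.of_forall hfibre)
  · exact (he.integrable_comp_emb e.measurableEmbedding).2 hint

theorem integral_unipotent_eq_unipotentIntegral (c : Composition n) (f : GL (Fin n) F → ℂ)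
    (g : GL (Fin n) F) :
    ∫ x : NilIndex c → F, f (g * unipotent c x) ∂(Measure.pi fun _ => haarF F) =
      unipotentIntegral (nilPositions c.index) f g := by
  have hmp := (measurePreserving_piCongrLeft (fun _ => haarF F) (nilIndexEquiv c)).symm
  rw [← hmp.integral_comp (MeasurableEquiv.measurableEmbedding _)]
  refine integral_congr_ae (.of_forall fun x => congrArg (fun u => f (g * u)) (Units.ext ?_))
  exact congrArg (1 + ·) (nilMatrix_comp_nilIndexEquiv c x)

end Integral

section BlockDet

variable {n : ℕ} {β : Type*} [LinearOrder β] {b : Fin n → β}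

/-- The determinant of the diagonal block `b i = d`; for block diagonal matrices these are the
coordinates of the map `M → GL_1 × ⋯ × GL_1` given by the determinants of the factors of `M`. -/
def blockDet {F : Type*} [Field F] (b : Fin n → β) (d : β) (g : GL (Fin n) F) : F :=
  (g.val.toSquareBlock b d).det

section Field

variable {F : Type*} [Field F]

theorem blockDet_mul (d : β) {g : GL (Fin n) F} (hg : g ∈ blockLevi b F) (h : GL (Fin n) F) :
    blockDet b d (g * h) = blockDet b d g * blockDet b d h := by
  have hblock : (g * h).val.toSquareBlock b d =
      g.val.toSquareBlock b d * h.val.toSquareBlock b d := by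
    ext i j
    rw [Matrix.mul_apply, Matrix.toSquareBlock_def, Matrix.of_apply, Units.val_mul,
      Matrix.mul_apply]
    refine (Finset.sum_subset (Finset.subset_univ (Finset.univ.filter fun k => b k = d))
      fun k _ hk => ?_).symm.trans (Finset.sum_subtype _ (by simp) _)
    rw [mem_blockLevi_iff.1 hg i k (by simpa [i.2, eq_comm] using hk), zero_mul]
  rw [blockDet, hblock, Matrix.det_mul, blockDet, blockDet]

theorem blockDet_eq_prod_diag (d : β) {g : GL (Fin n) F} (hg : ∀ i j, j < i → g i j = 0) :
    blockDet b d g = ∏ i : {i // b i = d}, g i i :=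
  Matrix.det_of_isUpperTriangular fun i j hij => hg i j hij

theorem blockDet_upperUnipotent (d : β) {s : Finset (UpperIndex n)} (x : s → F) :
    blockDet b d (upperUnipotent s x) = 1 := by
  rw [blockDet_eq_prod_diag d fun i j => upperUnipotent_apply_of_lt x]
  exact Finset.prod_eq_one fun i _ => upperUnipotent_apply_self x i

theorem blockDet_one (d : β) : blockDet b d (1 : GL (Fin n) F) = 1 := by
  rw [blockDet_eq_prod_diag d fun i j hij => Matrix.one_apply_ne hij.ne']
  simp

end Field

variable {F : Type*} [NontriviallyNormedField F] [IsUltrametricDist F]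

theorem norm_blockDet_of_mem_compactLevi (d : β) {k : GL (Fin n) F} (hk : k ∈ compactLevi b F) :
    ‖blockDet b d k‖ = 1 := by
  have hle {l : GL (Fin n) F} (hl : l ∈ compactLevi b F) : ‖blockDet b d l‖ ≤ 1 :=
    norm_det_le_one fun i j => norm_apply_le_one_of_mem_maximalCompact hl.1 _ _
  have hmul : ‖blockDet b d k‖ * ‖blockDet b d k⁻¹‖ = 1 := by
    rw [← norm_mul, ← blockDet_mul d hk.2, mul_inv_cancel, blockDet_one, norm_one]
  refine (hle hk).antisymm (hmul.symm.trans_le ?_)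
  exact mul_le_of_le_one_right (norm_nonneg _) (hle (inv_mem hk))

end BlockDet

section Peel

open MeasureTheory

variable {n : ℕ} {F : Type*} [NontriviallyNormedField F] {β γ : Type*} [LinearOrder β]
  [LinearOrder γ] {a : Fin n → γ} {b : Fin n → β} {J : Fin n} {f : GL (Fin n) F → ℂ}

theorem mul_upperUnipotent_nilPositions_apply_self {g : GL (Fin n) F} (hg : g ∈ blockLevi b F)
    (x : nilPositions b → F) (J : Fin n) : (g * upperUnipotent (nilPositions b) x) J J = g J J := by
  rw [Units.val_mul, Matrix.mul_apply, Finset.sum_eq_single J, upperUnipotent_apply_self, mul_one]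
  · intro k _ hk
    by_cases hb : b J = b k
    · rw [val_upperUnipotent, Matrix.add_apply, Matrix.one_apply_ne hk,
        upperMatrix_nilPositions_apply_eq_zero x hb.not_gt, add_zero, mul_zero]
    · rw [mem_blockLevi_iff.1 hg J k hb, zero_mul]
  · simp

variable [ProperSpace F] [MeasurableSpace F] [BorelSpace F]

theorem exists_norm_apply_le_of_unipotentIntegral_ne_zero (hf : HasCompactSupport f)
    (b : Fin n → β) (J : Fin n) : ∃ C : ℝ, ∀ g ∈ blockLevi b F,
      unipotentIntegral (nilPositions b) f g ≠ 0 → ‖g J J‖ ≤ C := by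
  have hcont : Continuous fun g : GL (Fin n) F => g J J := Units.continuous_val.matrix_elem J J
  obtain ⟨C, hC⟩ := hf.isCompact.exists_bound_of_continuousOn hcont.continuousOn
  refine ⟨C, fun g hg hne => ?_⟩
  obtain ⟨x, hx⟩ : ∃ x, f (g * upperUnipotent (nilPositions b) x) ≠ 0 := by
    by_contra! h
    exact hne (by simp [unipotentIntegral, h])
  simpa only [mul_upperUnipotent_nilPositions_apply_self hg] using hC _ (subset_tsupport f hx)

variable [IsUltrametricDist F]

theorem exists_pivot_unipotentIntegral (hf : IsUnramified f) (hb : Monotone b)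
    (hab : ∀ i j, b i = b j → a i = a j) {g : GL (Fin n) F} (hg : g ∈ blockLevi b F)
    (hne : unipotentIntegral (nilPositions b) f g ≠ 0) (J : Fin n) :
    ∃ h ∈ blockLevi b F, (∀ d, ‖blockDet a d h‖ = ‖blockDet a d g‖) ∧
      (∀ i ≠ J, h i J = 0) ∧ (∀ j ≠ J, h J j = 0) ∧
      unipotentIntegral (nilPositions b) f h ≠ 0 ∧
      ∀ v : rowPositions b J → F,
        unipotentIntegral (nilPositions b) f (h * upperUnipotent _ v) ≠ 0 → ‖v‖ ≤ 1 := by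
  let S : Set (GL (Fin n) F) := {h | h ∈ blockLevi b F ∧
    unipotentIntegral (nilPositions b) f h ≠ 0 ∧ ∀ d, ‖blockDet a d h‖ = ‖blockDet a d g‖}
  have hba : blockLevi b F ≤ blockLevi a F := blockLevi_mono hab F
  have hleft : ∀ k ∈ compactLevi b F, ∀ h ∈ S, k * h ∈ S := fun k hk h hh =>
    ⟨mul_mem hk.2 hh.1, (unipotentIntegral_mul_left hf hk.1 h).trans_ne hh.2.1, fun d => by
      rw [blockDet_mul d (hba hk.2), norm_mul,
        norm_blockDet_of_mem_compactLevi d (compactLevi_mono hab F hk), one_mul, hh.2.2]⟩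
  have hright : ∀ k ∈ compactLevi b F, ∀ h ∈ S, h * k ∈ S := fun k hk h hh =>
    ⟨mul_mem hh.1 hk.2, (unipotentIntegral_mul_right hf hb hk h).trans_ne hh.2.1, fun d => by
      rw [blockDet_mul d (hba hh.1), norm_mul,
        norm_blockDet_of_mem_compactLevi d (compactLevi_mono hab F hk), mul_one, hh.2.2]⟩
  obtain ⟨C, hC⟩ := exists_norm_apply_le_of_unipotentIntegral_ne_zero hf.hasCompactSupport b J
  obtain ⟨h, hh, hJ, hcol, hrow, hmax⟩ := exists_pivot (b := b)
    (S := S) ⟨g, hg, hne, fun _ => rfl⟩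
    (fun h hh => hh.1) hleft hright fun h hh => hC h hh.1 hh.2.1
  refine ⟨h, hh.1, hh.2.2, hcol, hrow, hh.2.1, fun v hv => ?_⟩
  have hmem : h * upperUnipotent _ v ∈ S :=
    ⟨mul_mem hh.1 (upperUnipotent_rowPositions_mem_blockLevi v), hv, fun d => by
      rw [blockDet_mul d (hba hh.1), blockDet_upperUnipotent, mul_one, hh.2.2]⟩
  refine (pi_norm_le_iff_of_nonneg zero_le_one).2 fun p => ?_
  obtain ⟨hpJ, hpb⟩ := mem_rowPositions.1 p.2
  have hle := hmax _ hmem p.1.1.2 hpb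
  rw [upperUnipotent_rowPositions, mul_rankOneUnipotent_single_apply,
    hrow _ (hpJ.symm.trans_lt p.1.2).ne', zero_add, norm_mul] at hle
  have hvp : upperMatrix (rowPositions b J) F v J p.1.1.2 = v p := by
    simpa only [hpJ] using upperMatrix_apply v p
  rw [hvp] at hle
  exact le_of_mul_le_mul_left (hle.trans_eq (mul_one _).symm) (norm_pos_iff.2 hJ)

theorem exists_unipotentIntegral_union_ne_zero (hf : IsUnramified f) (hb : Monotone b)
    (hab : ∀ i j, b i = b j → a i = a j) {g : GL (Fin n) F} (hg : g ∈ blockLevi b F)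
    (hne : unipotentIntegral (nilPositions b) f g ≠ 0) (J : Fin n) :
    ∃ h ∈ blockLevi b F, (∀ d, ‖blockDet a d h‖ = ‖blockDet a d g‖) ∧
      (∀ i ≠ J, h i J = 0) ∧ (∀ j ≠ J, h J j = 0) ∧
      unipotentIntegral (nilPositions b ∪ rowPositions b J) f h ≠ 0 := by
  obtain ⟨h, hh, hdet, hcol, hrow, hne', hv⟩ := exists_pivot_unipotentIntegral hf hb hab hg hne J
  refine ⟨h, hh, hdet, hcol, hrow, ?_⟩
  have hindicator (v : rowPositions b J → F) :
      unipotentIntegral (nilPositions b) f (h * upperUnipotent _ v) =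
        (Metric.closedBall 0 1).indicator (fun _ => unipotentIntegral (nilPositions b) f h) v := by
    by_cases hv1 : ‖v‖ ≤ 1
    · rw [Set.indicator_of_mem (mem_closedBall_zero_iff.2 hv1), unipotentIntegral_mul_right hf hb
        (upperUnipotent_rowPositions_mem_compactLevi hv1)]
    · rw [Set.indicator_of_notMem (mt mem_closedBall_zero_iff.1 hv1)]
      exact not_not.1 (mt (hv v) hv1)
  rw [unipotentIntegral_nilPositions_union_rowPositions hf.isLocallyConstant.continuous
    hf.hasCompactSupport hb, integral_congr_ae (.of_forall hindicator),
    integral_indicator_const _ Metric.isClosed_closedBall.measurableSet]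
  refine smul_ne_zero (ENNReal.toReal_ne_zero.2 ⟨?_, ?_⟩) hne'
  · exact (Metric.measure_closedBall_pos _ _ one_pos).ne'
  · exact (isCompact_closedBall _ _).measure_lt_top.ne

end Peel

section PeelOff

variable {n : ℕ} (c : Composition n) {J : ℕ}

/-- The partition of the indices into the singletons `{0}, …, {J - 1}` and the remainders of the
blocks of `c`, in this order. It goes from the blocks of `c` at `J = 0` to singletons at `J = n`. -/
def peel (J : ℕ) (i : Fin n) : ℕ :=
  if i < J then i else J + c.index i

variable {c}

theorem monotone_peel : Monotone (peel c J) := fun i j (hij : (i : ℕ) ≤ j) => by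
  have := Fin.le_def.1 (index_mono (c := c) hij)
  grind [peel]

theorem index_eq_of_peel_eq {i j : Fin n} (h : peel c J i = peel c J j) :
    c.index i = c.index j := by
  rw [Fin.ext_iff]
  grind [peel]

theorem nilPositions_congr {β γ : Type*} [LinearOrder β] [LinearOrder γ] {a : Fin n → γ}
    {b : Fin n → β} (h : ∀ i j, i < j → (a i < a j ↔ b i < b j)) :
    nilPositions a = nilPositions b :=
  Finset.filter_congr fun p _ => h _ _ p.2

theorem nilPositions_peel_zero : nilPositions (peel c 0) = nilPositions c.index :=
  nilPositions_congr fun i j _ => by simp [peel]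

theorem nilPositions_peel_succ (J : Fin n) :
    nilPositions (peel c (J + 1)) = nilPositions (peel c J) ∪ rowPositions (peel c J) J := by
  ext ⟨⟨i, j⟩, hij⟩
  have hJ : J ≤ j → c.index J ≤ c.index j := index_mono
  simp only [Finset.mem_union, mem_nilPositions, mem_rowPositions, peel]
  simp only [Fin.lt_def, Fin.le_def, Fin.ext_iff] at hij hJ ⊢
  grind

theorem mem_blockLevi_peel_succ {F : Type*} [Field F] {J : Fin n} {g : GL (Fin n) F}
    (hg : g ∈ blockLevi (peel c J) F) (hcol : ∀ i ≠ J, g i J = 0) (hrow : ∀ j ≠ J, g J j = 0) :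
    g ∈ blockLevi (peel c (J + 1)) F := fun i j hij => by
  by_cases hi : i = J
  · subst hi
    exact hrow j fun hj => hij (by rw [hj])
  by_cases hj : j = J
  · subst hj
    exact hcol i hi
  refine hg i j fun h => hij ?_
  grind [peel]

theorem val_index_ones (i : Fin n) : ((Composition.ones n).index i : ℕ) = i := by
  have h1 := (Composition.ones n).sizeUpTo_index_le i
  have h2 := (Composition.ones n).lt_sizeUpTo_index_succ i
  rw [Composition.ones_sizeUpTo] at h1 h2
  rw [Fin.val_succ] at h2
  omega

theorem nilPositions_peel_self :
    nilPositions (peel c n) = nilPositions (Composition.ones n).index :=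
  nilPositions_congr fun i j _ => by
    simp only [peel, Fin.is_lt, if_true, Fin.lt_def, val_index_ones]

theorem blockLevi_peel_self (F : Type*) [NontriviallyNormedField F] :
    blockLevi (peel c n) F = torus n F := by
  rw [torus, ← blockLevi_index]
  refine le_antisymm (blockLevi_mono (fun i j h => ?_) F) (blockLevi_mono (fun i j h => ?_) F) <;>
    simpa [peel, Fin.ext_iff, val_index_ones] using h

variable {F : Type*} [NontriviallyNormedField F] [IsUltrametricDist F] [ProperSpace F]
  [MeasurableSpace F] [BorelSpace F] {f : GL (Fin n) F → ℂ}

theorem exists_peel_unipotentIntegral_ne_zero (hf : IsUnramified f) {m : GL (Fin n) F}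
    (hm : m ∈ levi c F) (hne : unipotentIntegral (nilPositions c.index) f m ≠ 0) (hJ : J ≤ n) :
    ∃ g ∈ blockLevi (peel c J) F, (∀ d, ‖blockDet c.index d g‖ = ‖blockDet c.index d m‖) ∧
      unipotentIntegral (nilPositions (peel c J)) f g ≠ 0 := by
  induction J with
  | zero =>
    refine ⟨m, ?_, fun _ => rfl, nilPositions_peel_zero ▸ hne⟩
    rw [← blockLevi_index] at hm
    exact blockLevi_mono (fun i j h => by simp [peel, h]) F hm
  | succ J ih =>
    obtain ⟨g, hg, hdet, hne'⟩ := ih (Nat.le_of_succ_le hJ)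
    obtain ⟨h, hh, hdet', hcol, hrow, hne''⟩ := exists_unipotentIntegral_union_ne_zero hf
      monotone_peel (fun i j => index_eq_of_peel_eq) hg hne' ⟨J, hJ⟩
    exact ⟨h, mem_blockLevi_peel_succ hh hcol hrow, fun d => (hdet' d).trans (hdet d),
      nilPositions_peel_succ (c := c) ⟨J, hJ⟩ ▸ hne''⟩

theorem exists_torus_unipotentIntegral_ne_zero (hf : IsUnramified f) {m : GL (Fin n) F}
    (hm : m ∈ levi c F) (hne : unipotentIntegral (nilPositions c.index) f m ≠ 0) :
    ∃ t ∈ torus n F, (∀ d, ‖blockDet c.index d t‖ = ‖blockDet c.index d m‖) ∧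
      unipotentIntegral (nilPositions (Composition.ones n).index) f t ≠ 0 := by
  have h := exists_peel_unipotentIntegral_ne_zero hf hm hne le_rfl
  rwa [blockLevi_peel_self, nilPositions_peel_self] at h

end PeelOff

section Compact

theorem charpoly_toSquareBlock_dvd {ι β R : Type*} [Fintype ι] [DecidableEq ι] [LinearOrder β]
    [CommRing R] {b : ι → β} {A : Matrix ι ι R} (hA : A.BlockTriangular b)
    (d : β) : (A.toSquareBlock b d).charpoly ∣ A.charpoly := by
  by_cases hd : d ∈ Finset.univ.image b
  · rw [hA.charpoly]
    exact Finset.dvd_prod_of_mem (fun d => (A.toSquareBlock b d).charpoly) hd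
  · have : IsEmpty {i // b i = d} := ⟨fun i => hd (by simp [← i.2])⟩
    simp [Matrix.charpoly_isEmpty]

variable {n : ℕ} {F : Type*} [NontriviallyNormedField F] [IsUltrametricDist F]

theorem norm_det_eq_pow_of_forall_spectralNorm_eq [CompleteSpace F] {ι : Type*} [Fintype ι]
    [DecidableEq ι] {B : Matrix ι ι F} {x : ℝ}
    (h : ∀ y ∈ B.charpoly.aroots (AlgebraicClosure F),
      spectralNorm F (AlgebraicClosure F) y = x) :
    ‖B.det‖ = x ^ Fintype.card ι := by
  have hdet : algebraMap F (AlgebraicClosure F) B.det =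
      (B.charpoly.aroots (AlgebraicClosure F)).prod := by
    rw [RingHom.map_det, RingHom.mapMatrix_apply, Matrix.det_eq_prod_roots_charpoly,
      Matrix.charpoly_map, Polynomial.aroots_def]
  have hcard : (B.charpoly.aroots (AlgebraicClosure F)).card = Fintype.card ι := by
    rw [Polynomial.aroots_def, IsAlgClosed.card_roots_eq_natDegree, Polynomial.natDegree_map,
      Matrix.charpoly_natDegree_eq_dim]
  have hroots : ∀ y ∈ B.charpoly.aroots (AlgebraicClosure F),
      spectralMulAlgNorm F (AlgebraicClosure F) y = x := h
  rw [← spectralNorm_extends (L := AlgebraicClosure F) B.det, hdet, ← spectralMulAlgNorm_def,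
    map_multiset_prod, Multiset.map_congr rfl hroots, Multiset.map_const', Multiset.prod_replicate,
    hcard]

variable {β : Type*} [LinearOrder β] {b : Fin n → β}

theorem exists_norm_blockDet_eq_pow_card [CompleteSpace F] {m : GL (Fin n) F}
    (hm : m ∈ blockLevi b F) (hcpt : m ∈ compactElements n F) :
    ∃ x : ℝ, ∀ d, ‖blockDet b d m‖ = x ^ Fintype.card {i // b i = d} := by
  obtain ⟨x, hx⟩ : ∃ x, ∀ y ∈ m.val.charpoly.aroots (AlgebraicClosure F),
      spectralNorm F (AlgebraicClosure F) y = x := by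
    rcases (m.val.charpoly.aroots (AlgebraicClosure F)).empty_or_exists_mem with h | ⟨r, hr⟩
    · simp [h]
    · exact ⟨_, fun y hy => hcpt y hy r hr⟩
  have hchar : m.val.charpoly ≠ 0 := (Matrix.charpoly_monic _).ne_zero
  refine ⟨x, fun d => norm_det_eq_pow_of_forall_spectralNorm_eq fun y hy => hx y ?_⟩
  exact Multiset.mem_of_le (Polynomial.roots.le_of_dvd (Polynomial.map_ne_zero hchar)
    (Polynomial.map_dvd _ (charpoly_toSquareBlock_dvd (fun i j hij => hm i j hij.ne') d))) hy

end Compact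

section ConstantTerm

variable {n : ℕ} {c : Composition n} {F : Type*} [NontriviallyNormedField F]

theorem modularCharacter_pos {m : GL (Fin n) F} (hm : m ∈ levi c F) :
    0 < modularCharacter c m := by
  rw [← blockLevi_index] at hm
  let e := nilIndexEquiv c
  let L := LinearEquiv.funCongrLeft F F e.symm ≪≫ₗ
    nilMulEquiv (monotone_index c) hm (inv_mem hm) ≪≫ₗ LinearEquiv.funCongrLeft F F e
  have hL : adjointAction c m = L.toLinearMap := LinearMap.ext fun x => funext fun p => by
    have hx := nilMatrix_comp_nilIndexEquiv c (x ∘ e.symm)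
    rw [Function.comp_assoc, Equiv.symm_comp_self, Function.comp_id] at hx
    exact congrArg (fun X => (m.val * X * m⁻¹.val) p.1.1 p.1.2) hx
  rw [modularCharacter, hL, norm_pos_iff]
  exact L.isUnit_det'.ne_zero

theorem constantTerm_ne_zero_iff [ProperSpace F] [MeasurableSpace F] [BorelSpace F]
    {f : GL (Fin n) F → ℂ} {m : levi c F} :
    constantTerm c f m ≠ 0 ↔ unipotentIntegral (nilPositions c.index) f m ≠ 0 := by
  have hδ : ((modularCharacter c (m : GL (Fin n) F) ^ (1 / 2 : ℝ) : ℝ) : ℂ) ≠ 0 :=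
    Complex.ofReal_ne_zero.2 (Real.rpow_pos_of_pos (modularCharacter_pos m.2) _).ne'
  rw [constantTerm, integral_unipotent_eq_unipotentIntegral, mul_ne_zero_iff]
  exact and_iff_right hδ

end ConstantTerm

section SatakeSupport

variable {n : ℕ}

theorem exists_mem_support_of_toTorusFunction_ne_zero {F : Type*} [NontriviallyNormedField F]
    [IsUltrametricDist F] {ϖ : integers F} {Q : LaurentRing n} {t : torus n F}
    (h : toTorusFunction ϖ Q t ≠ 0) :
    ∃ l ∈ Q.coeff.support, ∀ i, ‖(t : GL (Fin n) F) i i‖ = ‖(ϖ : F)‖ ^ l i := by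
  obtain ⟨l, hl, hne⟩ := Finset.exists_ne_zero_of_sum_ne_zero h
  exact ⟨l, hl, (ite_ne_right_iff.1 hne).1⟩

theorem prod_zpow_eq_zpow_sum {ι G : Type*} [CommGroupWithZero G] (I : Finset ι) {r : G}
    (hr : r ≠ 0) (l : ι → ℤ) : ∏ i ∈ I, r ^ l i = r ^ ∑ i ∈ I, l i := by
  induction I using Finset.cons_induction with
  | empty => simp
  | cons i I hi ih => rw [Finset.prod_cons, Finset.sum_cons, ih, zpow_add₀ hr]

theorem card_mul_sum_eq_of_prod_zpow_eq_pow {κ : Type*} [Finite κ] [DecidableEq κ] {b : Fin n → κ}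
    {r x : ℝ} (h0 : 0 < r) (h1 : r ≠ 1) {l : Fin n → ℤ}
    (h : ∀ d, ∏ i : {i // b i = d}, r ^ l i = x ^ Fintype.card {i // b i = d}) (d : κ) :
    n * ∑ i : {i // b i = d}, l i = Fintype.card {i // b i = d} * ∑ i, l i := by
  have := Fintype.ofFinite κ
  have hall : r ^ ∑ i, l i = x ^ n := by
    calc r ^ ∑ i, l i = ∏ d, ∏ i : {i // b i = d}, r ^ l i := by
          rw [← prod_zpow_eq_zpow_sum _ h0.ne', Fintype.prod_fiberwise b fun i => r ^ l i]
      _ = ∏ d, ∏ _i : {i // b i = d}, x := Finset.prod_congr rfl fun d _ => by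
          rw [h, Finset.prod_const, Finset.card_univ]
      _ = x ^ n := by
          rw [Fintype.prod_fiberwise b fun _ => x, Finset.prod_const, Finset.card_univ,
            Fintype.card_fin]
  refine zpow_right_injective₀ h0 h1 ?_
  calc r ^ (n * ∑ i : {i // b i = d}, l i) = (∏ i : {i // b i = d}, r ^ l i) ^ n := by
        rw [prod_zpow_eq_zpow_sum _ h0.ne', mul_comm, zpow_mul, zpow_natCast]
    _ = (x ^ n) ^ Fintype.card {i // b i = d} := by rw [h, pow_right_comm]
    _ = r ^ (Fintype.card {i // b i = d} * ∑ i, l i) := by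
        rw [← hall, mul_comm, zpow_mul, zpow_natCast]

theorem exists_mem_support_of_mem_compactElements {F : Type*} [NontriviallyNormedField F]
    [IsUltrametricDist F] [ProperSpace F] [MeasurableSpace F] [BorelSpace F] {ϖ : integers F}
    (hϖ : Irreducible ϖ) {f : GL (Fin n) F → ℂ} (hf : IsUnramified f) {Q : LaurentRing n}
    (hQ : satake f = toTorusFunction ϖ Q) {c : Composition n} {m : levi c F}
    (hcpt : (m : GL (Fin n) F) ∈ compactElements n F) (hne : constantTerm c f m ≠ 0) :
    ∃ l ∈ Q.coeff.support, ∀ d, n * ∑ i : {i // c.index i = d}, l i =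
      Fintype.card {i // c.index i = d} * ∑ i, l i := by
  obtain ⟨t, ht, hdet, hft⟩ :=
    exists_torus_unipotentIntegral_ne_zero hf m.2 (constantTerm_ne_zero_iff.1 hne)
  obtain ⟨l, hl, hlt⟩ : ∃ l ∈ Q.coeff.support, ∀ i, ‖t i i‖ = ‖(ϖ : F)‖ ^ l i :=
    exists_mem_support_of_toTorusFunction_ne_zero (t := ⟨t, ht⟩)
      (hQ ▸ constantTerm_ne_zero_iff.2 hft)
  obtain ⟨x, hx⟩ := exists_norm_blockDet_eq_pow_card (b := c.index)
    (by rw [blockLevi_index]; exact m.2) hcpt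
  refine ⟨l, hl, card_mul_sum_eq_of_prod_zpow_eq_pow (x := x) (norm_pos_of_irreducible hϖ)
    (norm_lt_one_of_irreducible hϖ).ne fun d => ?_⟩
  have hdiag : blockDet c.index d t = ∏ i : {i // c.index i = d}, t i i :=
    blockDet_eq_prod_diag d fun i j hij => (mem_levi_iff _ F).1 ht i j fun h => hij.ne' <| by
      simpa [Fin.ext_iff, val_index_ones] using h
  rw [← hx, ← hdet, hdiag, norm_prod]
  exact Finset.prod_congr rfl fun i _ => (hlt i).symm

end SatakeSupport

section Kottwitz

variable {n : ℕ}

theorem prod_X_pow (I : Finset (Fin n)) (α : ℕ) :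
    (∏ i ∈ I, X i) ^ α =
      (AddMonoidAlgebra.single (fun i => if i ∈ I then (α : ℤ) else 0) 1 : LaurentRing n) := by
  have hprod : ∏ i ∈ I, X i =
      (AddMonoidAlgebra.single (∑ i ∈ I, Pi.single i 1) 1 : LaurentRing n) := by
    induction I using Finset.induction_on with
    | empty => simp [AddMonoidAlgebra.one_def]
    | insert i I hi ih =>
      rw [Finset.prod_insert hi, Finset.sum_insert hi, ih, X, AddMonoidAlgebra.single_mul_single,
        one_mul]
  rw [hprod, AddMonoidAlgebra.single_pow, one_pow]
  congr 1
  funext i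
  simp [Finset.sum_apply, Pi.single_apply]

theorem exists_of_mem_support_kottwitzPolynomial {q α s : ℕ} {l : Fin n → ℤ}
    (h : l ∈ (kottwitzPolynomial q n α s).coeff.support) :
    ∃ I : Finset (Fin n), I.card = s ∧ l = fun i => if i ∈ I then (α : ℤ) else 0 := by
  rw [Finsupp.mem_support_iff, kottwitzPolynomial, AddMonoidAlgebra.coeff_smul,
    Finsupp.smul_apply, AddMonoidAlgebra.coeff_sum, Finsupp.finsetSum_apply] at h
  obtain ⟨I, hI, hne⟩ := Finset.exists_ne_zero_of_sum_ne_zero (right_ne_zero_of_smul h)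
  refine ⟨I, (Finset.mem_powersetCard.1 hI).2, ?_⟩
  rw [prod_X_pow, AddMonoidAlgebra.coeff_single] at hne
  exact not_imp_comm.1 Finsupp.single_eq_of_ne hne

theorem dvd_card_of_mem_support_kottwitzPolynomial {κ : Type*} [DecidableEq κ] {b : Fin n → κ}
    {q α s : ℕ} (hα : 0 < α) (hcop : s.Coprime n) {l : Fin n → ℤ}
    (hl : l ∈ (kottwitzPolynomial q n α s).coeff.support) {d : κ}
    (h : n * ∑ i : {i // b i = d}, l i = Fintype.card {i // b i = d} * ∑ i, l i) :
    n ∣ Fintype.card {i // b i = d} := by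
  obtain ⟨I, rfl, rfl⟩ := exists_of_mem_support_kottwitzPolynomial hl
  have hsum {ι : Type} [Fintype ι] (p : ι → Prop) [DecidablePred p] :
      ∑ i, (if p i then (α : ℤ) else 0) = (Finset.univ.filter p).card * α := by
    rw [← Finset.sum_filter, Finset.sum_const, nsmul_eq_mul]
  rw [hsum, hsum, ← mul_assoc, ← mul_assoc, Finset.filter_univ_mem] at h
  have hcard := mul_right_cancel₀ (Int.natCast_ne_zero.2 hα.ne') h
  exact hcop.symm.dvd_of_dvd_mul_right (Dvd.intro _ (mod_cast hcard))

theorem exists_card_block_lt {c : Composition n} {F : Type*} [Field F]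
    (hP : parabolic c F ≠ ⊤) :
    ∃ d, 0 < Fintype.card {i // c.index i = d} ∧ Fintype.card {i // c.index i = d} < n := by
  obtain ⟨g, -, hg⟩ := SetLike.exists_of_lt hP.lt_top
  obtain ⟨i, j, hij⟩ : ∃ i j, c.index j < c.index i := by
    by_contra! h
    exact hg fun i j hij => absurd hij (h i j).not_gt
  refine ⟨c.index i, Fintype.card_pos_iff.2 ⟨⟨i, rfl⟩⟩, ?_⟩
  simpa using Fintype.card_subtype_lt (p := fun k => c.index k = c.index i) hij.ne

end Kottwitz

end KottwitzFunction

end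

theorem proposition5p1_general {F : Type*} [NontriviallyNormedField F] [IsUltrametricDist F]
    [ProperSpace F] [MeasurableSpace F] [BorelSpace F]
    (ϖ : KottwitzFunction.integers F) (hϖ : Irreducible ϖ)
    (n α s : ℕ) (hα : 0 < α) (hcop : Nat.Coprime s n)
    (f : GL (Fin n) F → ℂ) (hf : KottwitzFunction.IsKottwitzFunction ϖ α s f)
    (c : Composition n) (hP : KottwitzFunction.parabolic c F ≠ ⊤) :
    (fun m : KottwitzFunction.levi c F =>
      KottwitzFunction.compactIndicator n F (m : GL (Fin n) F) *
        KottwitzFunction.constantTerm c f m) = 0 := by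
  open KottwitzFunction in
  funext m
  by_contra hne
  obtain ⟨hcpt, hterm⟩ := mul_ne_zero_iff.1 hne
  obtain ⟨l, hl, hsum⟩ := exists_mem_support_of_mem_compactElements hϖ hf.isUnramified
    hf.satake_eq (Set.mem_of_indicator_ne_zero hcpt) hterm
  obtain ⟨d, hpos, hlt⟩ := exists_card_block_lt hP
  have hdvd := dvd_card_of_mem_support_kottwitzPolynomial hα hcop hl (hsum d)
  exact (Nat.le_of_dvd hpos hdvd).not_gt hlt

theorem proposition5p1 {F : Type*} [NontriviallyNormedField F] [IsUltrametricDist F]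
    [ProperSpace F] [CharZero F] [MeasurableSpace F] [BorelSpace F]
    (ϖ : KottwitzFunction.integers F) (hϖ : Irreducible ϖ)
    (hnorm : ‖(ϖ : F)‖ = (KottwitzFunction.residueCard F : ℝ)⁻¹)
    (n α s : ℕ) (hn : 0 < n) (hα : 0 < α) (hs : 0 < s) (hsn : s ≤ n) (hcop : Nat.Coprime s n)
    (f : GL (Fin n) F → ℂ) (hf : KottwitzFunction.IsKottwitzFunction ϖ α s f)
    (c : Composition n) (hP : KottwitzFunction.parabolic c F ≠ ⊤) :
    (fun m : KottwitzFunction.levi c F =>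
      KottwitzFunction.compactIndicator n F (m : GL (Fin n) F) *
        KottwitzFunction.constantTerm c f m) = 0 :=
  proposition5p1_general ϖ hϖ n α s hα hcop f hf c hP
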